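/- The rank of a partition is its largest part minus its number of parts. The crank of a partition is its largest part if $1$ is not a part, and $e(k)-k$ if $1$ appears exactly $k\ge 1$ times, where $e(k)$ is the number of parts strictly larger than $k$; the empty partition of $0$ has rank $0$ and crank $0$. For $m\in\mathbb{Z}$ and $n\ge 0$ let $N(m,n)$ be the number of partitions of $n$ with rank $m$, and let $M(m,n)$ be the number of partitions of $n$ with crank $m$, except that for $n=1$ one sets, as is customary, $M(0,1)=-1$, $M(-1,1)=M(1,1)=1$ and $M(m,1)=0$ for all other $m$. Write $(a;q)_\infty=\prod_{j=0}^\infty(1-aq^j)$. Theorem. As formal power series in $q$ whose coefficients are Laurent polynomials in $w$ over $\mathbb{Z}$ (all the sums and products below converge formally), $$\sum_{m=-\infty}^{\infty}\sum_{n=0}^{\infty}\bigl(N(3m,n)+N(3m+1,n)+N(3m-1,n)\bigr)w^m q^n=\frac{(q^3;q^3)_\infty}{(q;q)_\infty}\sum_{m=-\infty}^{\infty}\sum_{n=0}^{\infty}M(m,n)\,w^m q^{3n}.$$ -/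

import Mathlib

open scoped LaurentPolynomial PowerSeries PowerSeries.WithPiTopology

noncomputable section

namespace RankCrank

/-- The rank of a partition: its largest part minus its number of parts
(the empty partition has rank `0`). -/
def rank {n : ℕ} (p : n.Partition) : ℤ :=
  (p.parts.sup : ℤ) - (p.parts.card : ℤ)

/-- The crank of a partition: if `1` is not a part, the largest part (`0` for the empty partition);
if `1` appears `k ≥ 1` times, the number of parts strictly larger than `k`, minus `k`. -/
def crank {n : ℕ} (p : n.Partition) : ℤ :=
  if 1 ∈ p.parts then
    ((p.parts.countP fun i => p.parts.count 1 < i : ℕ) : ℤ) - (p.parts.count 1 : ℤ)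
  else (p.parts.sup : ℤ)

/-- `N(m, n)`: the number of partitions of `n` with rank `m`. -/
def N (m : ℤ) (n : ℕ) : ℤ :=
  ((Finset.univ.filter fun p : n.Partition => rank p = m).card : ℤ)

/-- `M(m, n)`: the number of partitions of `n` with crank `m` when `n ≠ 1`, with the customary
convention `M(0, 1) = -1`, `M(1, 1) = M(-1, 1) = 1` and `M(m, 1) = 0` otherwise. -/
def M (m : ℤ) (n : ℕ) : ℤ :=
  if n = 1 then (if m = 0 then -1 else if m = 1 ∨ m = -1 then 1 else 0)
  else ((Finset.univ.filter fun p : n.Partition => crank p = m).card : ℤ)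

/-- Laurent polynomials in `w` carry the discrete topology. With the product topology on power
series, infinite sums and products in `ℤ[w, w⁻¹]⟦q⟧` are then the usual formal ones. -/
instance instTopologicalSpaceLaurent : TopologicalSpace ℤ[T;T⁻¹] := ⊥

instance instDiscreteTopologyLaurent : DiscreteTopology ℤ[T;T⁻¹] := ⟨rfl⟩

/-- The formal variable `q`. -/
def q : ℤ[T;T⁻¹]⟦X⟧ := PowerSeries.X

/-- The monomial `w ^ m`, for an integer `m`. -/
def wPow (m : ℤ) : ℤ[T;T⁻¹]⟦X⟧ := PowerSeries.C (LaurentPolynomial.T m)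

/-- `(a; b)_∞ = ∏_{j ≥ 0} (1 - a b ^ j)`. -/
def qPochInf (a b : ℤ[T;T⁻¹]⟦X⟧) : ℤ[T;T⁻¹]⟦X⟧ := ∏' j : ℕ, (1 - a * b ^ j)

/-- The products `(q ^ k; q ^ k)_∞`, `k ≥ 1`, converge. -/
theorem multipliable_qPochInf (k : ℕ) (hk : 0 < k) :
    Multipliable fun j : ℕ => (1 - q ^ k * (q ^ k) ^ j : ℤ[T;T⁻¹]⟦X⟧) := by
  have h := (PowerSeries.WithPiTopology.multipliable_one_add_of_tendsto_order_atTop_nhds_top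
    (R := ℤ[T;T⁻¹]) (f := fun j : ℕ => -(q ^ k * (q ^ k) ^ j)) ?_)
  · simpa [sub_eq_add_neg] using h
  · refine ENat.tendsto_nhds_top_iff_natCast_lt.mpr fun n => ?_
    filter_upwards [Filter.eventually_ge_atTop n] with j hj
    rw [PowerSeries.order_neg, ← pow_succ', ← pow_mul, q, PowerSeries.order_X_pow]
    have : n < k * (j + 1) := by nlinarith
    exact_mod_cast this

/-- `(q; q)_∞` has constant term `1`. -/
theorem constantCoeff_qPochInf : PowerSeries.constantCoeff (qPochInf q q) = 1 := by
  have h := multipliable_qPochInf 1 one_pos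
  simp only [pow_one] at h
  rw [qPochInf, h.map_tprod (PowerSeries.constantCoeff (R := ℤ[T;T⁻¹]))
    (PowerSeries.WithPiTopology.continuous_constantCoeff ℤ[T;T⁻¹])]
  simp [q]

/-- `1 / (q; q)_∞`. -/
def invQPochInf : ℤ[T;T⁻¹]⟦X⟧ := PowerSeries.invOfUnit (qPochInf q q) 1

/-- `invQPochInf` is the multiplicative inverse of `(q; q)_∞`. -/
theorem qPochInf_mul_inv : qPochInf q q * invQPochInf = 1 :=
  PowerSeries.mul_invOfUnit _ _ (by simpa using constantCoeff_qPochInf)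

end RankCrank

end

noncomputable section

namespace RankCrank

/-! Write P for the generating function of all partitions. The identity is compared one power of w
at a time: both sides are built from tails (rank or crank at least a bound) that satisfy the same
recursion. Rank: Dyson's map replaces the first column of a Ferrers diagram, of length l, by a part
l + r. For r ≥ 2 it matches rank at most r + 1 with rank at least r - 1 and adds r to the size
(`gf_le_rank`). With r = 3m, the series A m of partitions with rank at least 3m - 1 satisfies A m =
q^(3m) (P - A (m + 1)). The conjugate map (`gf_rank_le`) treats the lower tails. Crank: sorting
partitions by the number k of ones and the number of parts above k gives the series of M(m, ·) as (1
- q) `rectSum 1 1 m`, for crank m and, by symmetry, -m. This equals B m - B (m + 1) with B m =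
`rectSum 0 1 m`, and the Durfee rectangle identity `rectSum_zero_zero` yields B m = q^m (P - B (m +
1)). After q is replaced by q^3 in B, the series P(q^3) A m and P(q) B m (q^3) obey one recursion,
which has a unique solution (`eq_of_rec`). Differences of consecutive tails give the coefficients of
w^m for m ≠ 0; for m = 0 both tails are removed from P. Finally P(q) = 1/(q;q)_∞ turns P(q)/P(q^3)
into the stated quotient. -/

/-! ### Generating functions of classes of partitions -/

open Classical in
/-- The generating function of the partitions whose multiset of parts satisfies `S`. -/
def gf (S : Multiset ℕ → Prop) : ℤ⟦X⟧ :=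
  PowerSeries.mk fun n => ((Finset.univ.filter fun p : n.Partition => S p.parts).card : ℤ)

theorem coeff_gf (S : Multiset ℕ → Prop) (n : ℕ)
    [DecidablePred fun p : n.Partition => S p.parts] :
    PowerSeries.coeff n (gf S) =
      ((Finset.univ.filter fun p : n.Partition => S p.parts).card : ℤ) := by
  rw [gf, PowerSeries.coeff_mk]
  congr

theorem zero_notMem_parts {n : ℕ} (p : n.Partition) : 0 ∉ p.parts := fun h =>
  lt_irrefl _ (p.parts_pos h)

theorem gf_congr {S T : Multiset ℕ → Prop} (h : ∀ s, 0 ∉ s → (S s ↔ T s)) : gf S = gf T := by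
  classical
  ext n
  rw [coeff_gf, coeff_gf]
  congr 2
  ext p
  simp [h p.parts (zero_notMem_parts p)]

theorem gf_split (S A : Multiset ℕ → Prop) :
    gf S = gf (fun s => A s ∧ S s) + gf (fun s => ¬ A s ∧ S s) := by
  classical
  ext n
  rw [map_add, coeff_gf, coeff_gf, coeff_gf, ← Nat.cast_add,
    ← Finset.card_filter_add_card_filter_not (fun p : n.Partition => A p.parts),
    Finset.filter_filter, Finset.filter_filter]
  simp only [and_comm]

/-- A bijection of partitions that adds `d` to the size multiplies the generating function
by `X ^ d`. -/
theorem gf_shift {S T : Multiset ℕ → Prop} (d : ℕ) (f g : Multiset ℕ → Multiset ℕ)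
    (hf : ∀ s, 0 ∉ s → S s → 0 ∉ f s ∧ T (f s) ∧ (f s).sum = s.sum + d ∧ g (f s) = s)
    (hg : ∀ t, 0 ∉ t → T t → 0 ∉ g t ∧ S (g t) ∧ f (g t) = t) :
    gf T = PowerSeries.X ^ d * gf S := by
  classical
  have hsum : ∀ t, 0 ∉ t → T t → t.sum = (g t).sum + d := fun t h0 ht => by
    obtain ⟨h1, h2, h3⟩ := hg t h0 ht
    rw [← (hf _ h1 h2).2.2.1, h3]
  have hpos : ∀ s : Multiset ℕ, 0 ∉ s → ∀ {i}, i ∈ s → 0 < i := fun s h i hi =>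
    Nat.pos_of_ne_zero fun h0 => h (h0 ▸ hi)
  ext n
  rw [PowerSeries.coeff_X_pow_mul', coeff_gf]
  split_ifs with hd
  · rw [coeff_gf, Nat.cast_inj]
    refine Finset.card_bij'
      (fun p hp => ⟨g p.parts, fun {i} hi => hpos _ (hg _ (zero_notMem_parts p) (by simpa using hp)).1 hi, ?_⟩)
      (fun p hp => ⟨f p.parts, fun {i} hi => hpos _ (hf _ (zero_notMem_parts p) (by simpa using hp)).1 hi, ?_⟩)
      ?_ ?_ ?_ ?_
    · have := hsum _ (zero_notMem_parts p) (by simpa using hp)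
      rw [p.parts_sum] at this
      omega
    · have := (hf _ (zero_notMem_parts p) (by simpa using hp)).2.2.1
      rw [p.parts_sum] at this
      omega
    · intro p hp
      simpa using (hg _ (zero_notMem_parts p) (by simpa using hp)).2.1
    · intro p hp
      simpa using (hf _ (zero_notMem_parts p) (by simpa using hp)).2.1
    · intro p hp
      ext1
      exact (hg _ (zero_notMem_parts p) (by simpa using hp)).2.2
    · intro p hp
      ext1
      exact (hf _ (zero_notMem_parts p) (by simpa using hp)).2.2.2
  · rw [Nat.cast_eq_zero, Finset.card_eq_zero, Finset.filter_eq_empty_iff]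
    intro p _ hp
    have := hsum _ (zero_notMem_parts p) hp
    rw [p.parts_sum] at this
    omega

theorem hasSum_gf (S : Multiset ℕ → Prop) (φ : Multiset ℕ → ℕ) :
    HasSum (fun k => gf fun s => S s ∧ φ s = k) (gf S) := by
  classical
  rw [PowerSeries.WithPiTopology.hasSum_iff_hasSum_coeff]
  intro n
  set F := (Finset.univ.filter fun p : n.Partition => S p.parts) with hF
  have h1 : F.card = ∑ k ∈ F.image fun p => φ p.parts, (F.filter fun p => φ p.parts = k).card :=
    Finset.card_eq_sum_card_image _ _
  have h2 : PowerSeries.coeff n (gf S) = ∑ k ∈ F.image fun p => φ p.parts,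
      PowerSeries.coeff n (gf fun s => S s ∧ φ s = k) := by
    rw [coeff_gf, ← hF, h1, Nat.cast_sum]
    refine Finset.sum_congr rfl fun k _ => ?_
    rw [coeff_gf, hF, Finset.filter_filter]
  rw [h2]
  refine hasSum_sum_of_ne_finset_zero fun k hk => ?_
  rw [coeff_gf, Nat.cast_eq_zero, Finset.card_eq_zero, Finset.filter_eq_empty_iff]
  rintro p - ⟨hp, rfl⟩
  exact hk (Finset.mem_image.mpr ⟨p, by simpa [hF] using hp, rfl⟩)

/-- Removing one copy of the part `i`. -/
theorem gf_mem_and (S : Multiset ℕ → Prop) {i : ℕ} (hi : i ≠ 0) :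
    gf (fun s => i ∈ s ∧ S s) = PowerSeries.X ^ i * gf (fun s => S (i ::ₘ s)) := by
  refine gf_shift i (fun s => i ::ₘ s) (fun s => s.erase i) ?_ ?_
  · intro s h0 hs
    simp [h0, hs, hi.symm, add_comm]
  · rintro t h0 ⟨h1, h2⟩
    rw [Multiset.cons_erase h1]
    exact ⟨fun h => h0 (Multiset.mem_of_mem_erase h), h2, rfl⟩

/-- Removing `r` copies of the part `1`. -/
theorem gf_le_count_one (S : Multiset ℕ → Prop) (r : ℕ) :
    gf (fun s => r ≤ s.count 1 ∧ S s) =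
      PowerSeries.X ^ r * gf (fun s => S (s + Multiset.replicate r 1)) := by
  refine gf_shift r (fun s => s + Multiset.replicate r 1)
    (fun s => s - Multiset.replicate r 1) ?_ ?_
  · intro s h0 hs
    simp [h0, hs, Multiset.mem_replicate]
  · rintro t h0 ⟨h1, h2⟩
    have h3 := Multiset.sub_add_cancel (Multiset.le_count_iff_replicate_le.mp h1)
    exact ⟨fun h => h0 (Multiset.mem_of_le (Multiset.sub_le_self _ _) h), by rwa [h3], h3⟩

/-- Decreasing by one all parts larger than `k + 1`, when `k + 1` is not a part. -/
theorem gf_notMem_countP (k j : ℕ) :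
    gf (fun s => k + 1 ∉ s ∧ s.countP (k + 1 < ·) = j) =
      PowerSeries.X ^ j * gf (fun s => s.countP (k < ·) = j) := by
  have hsum : ∀ s : Multiset ℕ, (s.map fun i => if k < i then i + 1 else i).sum =
      s.sum + s.countP (k < ·) := fun s => by
    induction s using Multiset.induction with
    | empty => simp
    | cons a s ih =>
      rw [Multiset.map_cons, Multiset.sum_cons, ih, Multiset.sum_cons, Multiset.countP_cons]
      split_ifs <;> omega
  refine gf_shift j (fun s => s.map fun i => if k < i then i + 1 else i)
    (fun s => s.map fun i => if k + 1 < i then i - 1 else i) ?_ ?_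
  · intro s h0 hs
    refine ⟨?_, ⟨?_, ?_⟩, ?_, ?_⟩
    · rw [Multiset.mem_map]
      rintro ⟨i, hi, h⟩
      split_ifs at h
      exact h0 (h ▸ hi)
    · rw [Multiset.mem_map]
      rintro ⟨i, hi, h⟩
      split_ifs at h <;> omega
    · rw [← hs, Multiset.countP_map, Multiset.countP_eq_card_filter]
      congr 1
      refine Multiset.filter_congr fun i _ => ?_
      split_ifs <;> omega
    · rw [hsum, hs]
    · rw [Multiset.map_map]
      conv_rhs => rw [← Multiset.map_id s]
      refine Multiset.map_congr rfl fun i _ => ?_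
      simp only [Function.comp, id]
      split_ifs <;> omega
  · rintro t h0 ⟨h1, h2⟩
    have hne : ∀ i ∈ t, i ≠ k + 1 := fun i hi h => h1 (h ▸ hi)
    refine ⟨?_, ?_, ?_⟩
    · rw [Multiset.mem_map]
      rintro ⟨i, hi, h⟩
      split_ifs at h
      · omega
      · exact h0 (h ▸ hi)
    · rw [← h2, Multiset.countP_map, Multiset.countP_eq_card_filter]
      congr 1
      refine Multiset.filter_congr fun i hi => ?_
      have := hne i hi
      split_ifs <;> omega
    · rw [Multiset.map_map]
      conv_rhs => rw [← Multiset.map_id t]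
      refine Multiset.map_congr rfl fun i hi => ?_
      have := hne i hi
      simp only [Function.comp, id]
      split_ifs <;> omega

/-! ### Bounded parts, and the number of parts above a threshold -/

/-- The generating function of the partitions with all parts at most `k`. -/
def gfLE (k : ℕ) : ℤ⟦X⟧ := gf fun s => ∀ i ∈ s, i ≤ k

theorem gf_eq_zero : gf (fun s => s = 0) = 1 := by
  ext n
  rw [coeff_gf, PowerSeries.coeff_one]
  split_ifs with h
  · subst h
    simp
  · rw [Nat.cast_eq_zero, Finset.card_eq_zero, Finset.filter_eq_empty_iff]
    intro p _ hp
    have := p.parts_sum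
    simp [hp] at this
    omega

theorem gfLE_zero : gfLE 0 = 1 := by
  rw [← gf_eq_zero]
  refine gf_congr fun s h0 => ⟨fun h => ?_, fun h => by simp [h]⟩
  refine Multiset.eq_zero_of_forall_notMem fun i hi => h0 ?_
  rwa [Nat.le_zero.mp (h i hi)] at hi

/-- Either k + 1 is a part and one copy can be removed, or all parts are at most k. Hence `gfLE k`
is 1/(q)ₖ. -/
theorem one_sub_mul_gfLE (k : ℕ) :
    (1 - PowerSeries.X ^ (k + 1)) * gfLE (k + 1) = gfLE k := by
  have h := gf_split (fun s => ∀ i ∈ s, i ≤ k + 1) (fun s => k + 1 ∈ s)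
  rw [gf_mem_and _ (i := k + 1) (Nat.succ_ne_zero k),
    gf_congr (S := fun s => ∀ i ∈ (k + 1) ::ₘ s, i ≤ k + 1) (T := fun s => ∀ i ∈ s, i ≤ k + 1)
      fun s _ => by simp,
    gf_congr (S := fun s => k + 1 ∉ s ∧ ∀ i ∈ s, i ≤ k + 1) (T := fun s => ∀ i ∈ s, i ≤ k)
      fun s _ => ⟨fun ⟨h1, h2⟩ i hi => ?_, fun h => ⟨fun h1 => ?_, fun i hi => ?_⟩⟩] at h
  · change gfLE (k + 1) = _ * gfLE (k + 1) + gfLE k at h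
    linear_combination h
  · exact Nat.le_of_lt_succ (lt_of_le_of_ne (h2 i hi) fun h' => h1 ((show i = k + 1 from h') ▸ hi))
  · have := h _ h1
    omega
  · have := h i hi
    omega

theorem one_sub_X_pow_ne_zero (k : ℕ) : (1 - PowerSeries.X ^ (k + 1) : ℤ⟦X⟧) ≠ 0 := fun h => by
  simpa using congrArg PowerSeries.constantCoeff h

/-- A copy of k + 1 can be removed without changing the count; if there is none, the j larger parts
can each be lowered by one. -/
theorem one_sub_mul_gf_countP (k j : ℕ) :
    (1 - PowerSeries.X ^ (k + 1)) * gf (fun s => s.countP (k + 1 < ·) = j) =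
      PowerSeries.X ^ j * gf (fun s => s.countP (k < ·) = j) := by
  have h := gf_split (fun s => s.countP (k + 1 < ·) = j) (fun s => k + 1 ∈ s)
  rw [gf_mem_and _ (i := k + 1) (Nat.succ_ne_zero k), gf_notMem_countP] at h
  simp only [lt_self_iff_false, not_false_eq_true, Multiset.countP_cons_of_neg] at h
  linear_combination h

theorem countP_zero_lt {s : Multiset ℕ} (h0 : 0 ∉ s) : s.countP (0 < ·) = s.card :=
  Multiset.countP_eq_card.mpr fun _ hi => Nat.pos_of_ne_zero fun h => h0 (h ▸ hi)

/-- The induction splits on whether 1 is a part: either a 1 is removed, or all j + 1 parts are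
lowered by one. This replaces conjugation of Ferrers diagrams. -/
theorem gf_countP_zero (j : ℕ) :
    gf (fun s => s.countP (0 < ·) = j) = PowerSeries.X ^ j * gfLE j := by
  induction j with
  | zero =>
    rw [gfLE_zero, pow_zero, one_mul, ← gf_eq_zero]
    refine gf_congr fun s h0 => ?_
    rw [countP_zero_lt h0, Multiset.card_eq_zero]
  | succ j ih =>
    have h := gf_split (fun s => s.countP (0 < ·) = j + 1) (fun s => 0 + 1 ∈ s)
    have h2 : gf (fun s => 0 + 1 ∉ s ∧ s.countP (0 < ·) = j + 1) =
        gf (fun s => 0 + 1 ∉ s ∧ s.countP (0 + 1 < ·) = j + 1) := by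
      refine gf_congr fun s h0 => and_congr_right fun h1 => ?_
      rw [Multiset.countP_congr (p := (0 < ·)) (p' := (0 + 1 < ·)) rfl fun i hi => ?_]
      have h2 : i ≠ 0 := fun h => h0 (h ▸ hi)
      have h3 : i ≠ 0 + 1 := fun h => h1 (h ▸ hi)
      simp only [eq_iff_iff]
      omega
    rw [gf_mem_and _ (i := 0 + 1) one_ne_zero, h2, gf_notMem_countP] at h
    simp only [zero_add, zero_lt_one, Multiset.countP_cons_of_pos, add_left_inj, ih] at h
    refine mul_left_cancel₀ (one_sub_X_pow_ne_zero j) ?_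
    linear_combination h - PowerSeries.X ^ (j + 1) * one_sub_mul_gfLE j

theorem gf_countP (k j : ℕ) :
    gf (fun s => s.countP (k < ·) = j) = PowerSeries.X ^ (k * j + j) * gfLE k * gfLE j := by
  induction k with
  | zero => rw [gf_countP_zero, gfLE_zero, zero_mul, zero_add, mul_one]
  | succ k ih =>
    refine mul_left_cancel₀ (one_sub_X_pow_ne_zero k) ?_
    rw [one_sub_mul_gf_countP, ih, ← one_sub_mul_gfLE k]
    ring

/-! ### Durfee rectangle sums and their recursions -/

open PowerSeries (X)

theorem summable_X_pow_mul {e : ℕ → ℕ} (he : ∀ k, k ≤ e k) (u : ℕ → ℤ⟦X⟧) :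
    Summable fun k => X ^ e k * u k := by
  refine PowerSeries.WithPiTopology.summable_iff_summable_coeff _ |>.mpr fun n => ?_
  refine summable_of_hasFiniteSupport ((Set.finite_Iic n).subset fun k hk => ?_)
  rw [Function.mem_support, PowerSeries.coeff_X_pow_mul'] at hk
  have : e k ≤ n := by
    by_contra h
    simp [h] at hk
  exact (he k).trans this

/-- `∑ₖ q ^ ((k + m) k + c k + d (k + m)) / ((q)ₖ (q)ₖ₊ₘ)`. -/
def rectSum (c d m : ℕ) : ℤ⟦X⟧ :=
  ∑' k : ℕ, X ^ ((k + m) * k + c * k + d * (k + m)) * (gfLE k * gfLE (k + m))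

theorem hasSum_rectSum (c d m : ℕ) :
    HasSum (fun k => X ^ ((k + m) * k + c * k + d * (k + m)) * (gfLE k * gfLE (k + m)))
      (rectSum c d m) := by
  refine (summable_X_pow_mul (fun k => ?_) _).hasSum
  rcases Nat.eq_zero_or_pos k with rfl | hk
  · simp
  · nlinarith [Nat.zero_le (d * (k + m)), Nat.zero_le (c * k)]

/-- Cancelling a factor of `(q)ₖ`. -/
theorem rectSum_sub_succ_left (c d m : ℕ) :
    rectSum c d m - rectSum (c + 1) d m = X ^ c * rectSum c (d + 1) (m + 1) := by
  have h1 := (hasSum_rectSum c d m).sub (hasSum_rectSum (c + 1) d m)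
  -- The difference carries a factor 1 - q^k, so its term at k = 0 vanishes and the sum may be
  -- reindexed from k + 1.
  have h2 := (hasSum_nat_add_iff' 1).mpr h1
  have h3 := (hasSum_rectSum c (d + 1) (m + 1)).mul_left (X ^ c)
  simp only [Finset.range_one, Finset.sum_singleton, mul_zero, zero_add, add_zero, sub_self,
    sub_zero] at h2
  refine h2.unique (h3.congr_fun fun k => ?_)
  rw [← one_sub_mul_gfLE k, show k + 1 + m = k + (m + 1) by omega]
  ring

/-- Cancelling a factor of `(q)ₖ₊ₘ₊₁`. -/
theorem rectSum_sub_succ_right (c d m : ℕ) :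
    rectSum c d (m + 1) - rectSum c (d + 1) (m + 1) = X ^ d * rectSum (c + 1) d m := by
  have h1 := (hasSum_rectSum c d (m + 1)).sub (hasSum_rectSum c (d + 1) (m + 1))
  have h3 := (hasSum_rectSum (c + 1) d m).mul_left (X ^ d)
  refine h1.unique (h3.congr_fun fun k => ?_)
  rw [← one_sub_mul_gfLE (k + m), show k + (m + 1) = k + m + 1 by omega]
  ring

theorem rectSum_zero_one (m : ℕ) : rectSum 0 1 m = X ^ m * rectSum 1 0 m := by
  refine (hasSum_rectSum 0 1 m).unique
    (((hasSum_rectSum 1 0 m).mul_left (X ^ m)).congr_fun fun k => ?_)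
  ring

/-- The generating function of all partitions. -/
def gfAll : ℤ⟦X⟧ := gf fun _ => True

theorem coeff_gfLE {k n : ℕ} (h : n ≤ k) :
    PowerSeries.coeff n (gfLE k) = PowerSeries.coeff n gfAll := by
  classical
  rw [gfLE, gfAll, coeff_gf, coeff_gf]
  congr 2
  ext p
  simpa using fun i hi => (p.le_of_mem_parts hi).trans h

/-- The generating function of partitions by the size of their Durfee rectangle. -/
theorem rectSum_zero_zero (m : ℕ) : rectSum 0 0 m = gfAll := by
  -- For m and for m + 1 the sum equals `rectSum 1 0 m + rectSum 0 1 (m + 1)`, by cancelling on the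
  -- left and on the right respectively.
  have hconst : ∀ m, rectSum 0 0 m = rectSum 0 0 0 := fun m => by
    induction m with
    | zero => rfl
    | succ m ih =>
      have h1 := rectSum_sub_succ_left 0 0 m
      have h2 := rectSum_sub_succ_right 0 0 m
      rw [← ih]
      linear_combination h2 - h1
  ext n
  -- For the coefficient of q^n take m = n: the terms with k ≥ 1 start beyond q^n, and the term k =
  -- 0 is `gfLE n`, which agrees with P up to q^n.
  rw [hconst m, ← hconst n]
  have h := (PowerSeries.WithPiTopology.hasSum_iff_hasSum_coeff _).mp (hasSum_rectSum 0 0 n) n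
  refine h.unique ?_
  have h0 : PowerSeries.coeff n gfAll = PowerSeries.coeff n
      (X ^ ((0 + n) * 0 + 0 * 0 + 0 * (0 + n)) * (gfLE 0 * gfLE (0 + n))) := by
    simp [gfLE_zero, coeff_gfLE]
  rw [h0]
  refine hasSum_single (f := fun k => PowerSeries.coeff n
    (X ^ ((k + n) * k + 0 * k + 0 * (k + n)) * (gfLE k * gfLE (k + n)))) 0 fun k hk => ?_
  rw [PowerSeries.coeff_X_pow_mul', if_neg]
  have : 1 ≤ k := Nat.one_le_iff_ne_zero.mpr hk
  nlinarith

/-- The recursion satisfied by the partitions with crank at least `m`. -/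
theorem rectSum_zero_one_rec (m : ℕ) :
    rectSum 0 1 m = X ^ m * (gfAll - rectSum 0 1 (m + 1)) := by
  have h := rectSum_sub_succ_left 0 0 m
  rw [rectSum_zero_zero, zero_add, pow_zero, one_mul] at h
  rw [rectSum_zero_one m]
  linear_combination -X ^ m * h

/-- Eliminates `rectSum 0 2 (m + 1)` between the left and right cancellations. It makes `rectSum 0 1
m` the tail sum of the crank series. -/
theorem one_sub_X_mul_rectSum (m : ℕ) :
    (1 - X) * rectSum 1 1 m = rectSum 0 1 m - rectSum 0 1 (m + 1) := by
  have h1 := rectSum_sub_succ_left 0 1 m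
  have h2 := rectSum_sub_succ_right 0 1 m
  simp only [zero_add, pow_zero, one_mul, pow_one] at h1 h2
  linear_combination h2 - h1

/-- The recursion `A m = q ^ (3 m) (P - A (m + 1))` for `m ≥ 1` has only one solution. -/
theorem eq_of_rec {A B : ℕ → ℤ⟦X⟧} {P : ℤ⟦X⟧}
    (hA : ∀ m, 1 ≤ m → A m = X ^ (3 * m) * (P - A (m + 1)))
    (hB : ∀ m, 1 ≤ m → B m = X ^ (3 * m) * (P - B (m + 1))) {m : ℕ} (hm : 1 ≤ m) :
    A m = B m := by
  have key : ∀ r m, 1 ≤ m → (X : ℤ⟦X⟧) ^ r ∣ A m - B m := by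
    intro r
    induction r with
    | zero => simp
    | succ r ih =>
      intro m hm
      -- Since 3m ≥ 1, each use of the recursion gains a factor X, so the difference is divisible by
      -- every power of X.
      have h : A m - B m = X ^ (3 * m) * -(A (m + 1) - B (m + 1)) := by
        rw [hA m hm, hB m hm]
        ring
      rw [h, pow_succ']
      exact mul_dvd_mul (dvd_pow_self _ (by omega)) ((ih (m + 1) (by omega)).neg_right)
  ext n
  have := PowerSeries.X_pow_dvd_iff.mp (key (n + 1) m hm) n (Nat.lt_succ_self n)
  rwa [map_sub, sub_eq_zero] at this

/-! ### The crank generating function -/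

/-- The crank of the partition with multiset of parts `s`. -/
def crankParts (s : Multiset ℕ) : ℤ :=
  if 1 ∈ s then ((s.countP fun i => s.count 1 < i : ℕ) : ℤ) - (s.count 1 : ℤ) else (s.sup : ℤ)

/-- The only partition of 1 has crank -1, so the convention at n = 1 alters the true count only for
m = 0 and m = 1. -/
theorem mk_M (m : ℤ) : PowerSeries.mk (M m) =
    gf (fun s => crankParts s = m) + (if m = 0 then -X else if m = 1 then X else 0) := by
  ext n
  rw [PowerSeries.coeff_mk, map_add, coeff_gf, M]
  rcases eq_or_ne n 1 with rfl | hn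
  · have h1 : ∀ p : Nat.Partition 1, crankParts p.parts = m ↔ m = -1 := fun p => by
      have h2 : Multiset.countP (1 < ·) {1} = 0 := rfl
      simp [crankParts, h2, eq_comm]
    simp only [h1]
    by_cases h2 : m = -1
    · simp [h2]
    · by_cases h3 : m = 0
      · simp [h3]
      · by_cases h4 : m = 1 <;> simp [h2, h3, h4]
  · have h1 : PowerSeries.coeff n (if m = 0 then -X else if m = 1 then X else 0 : ℤ⟦X⟧) = 0 := by
      split_ifs <;> simp [PowerSeries.coeff_X, hn]
    rw [if_neg hn, h1, add_zero]
    rfl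

/-- "Exactly k ones" is "at least k" minus "at least k + 1". As k ≥ 1, ones do not affect the number
of parts above k, so removing them leaves the series of `gf_countP`. -/
theorem gf_count_one_eq {k : ℕ} (hk : 1 ≤ k) (j : ℕ) :
    gf (fun s => s.count 1 = k ∧ s.countP (k < ·) = j) =
      (1 - X) * (X ^ (j * k + 1 * k + 1 * j) * (gfLE k * gfLE j)) := by
  have h := gf_split (fun s => k ≤ s.count 1 ∧ s.countP (k < ·) = j) (fun s => k + 1 ≤ s.count 1)
  have h1 : gf (fun s => k + 1 ≤ s.count 1 ∧ k ≤ s.count 1 ∧ s.countP (k < ·) = j) =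
      gf (fun s => k + 1 ≤ s.count 1 ∧ s.countP (k < ·) = j) :=
    gf_congr fun s _ => by omega
  have h2 : gf (fun s => ¬ k + 1 ≤ s.count 1 ∧ k ≤ s.count 1 ∧ s.countP (k < ·) = j) =
      gf (fun s => s.count 1 = k ∧ s.countP (k < ·) = j) :=
    gf_congr fun s _ => by omega
  have h3 : ∀ r, gf (fun s => (s + Multiset.replicate r 1).countP (k < ·) = j) =
      gf (fun s => s.countP (k < ·) = j) := fun r =>
    gf_congr fun s _ => by
      have h : (Multiset.replicate r 1).countP (k < ·) = 0 :=
        Multiset.countP_eq_zero.mpr fun i hi => by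
          rw [Multiset.eq_of_mem_replicate hi]
          omega
      rw [Multiset.countP_add, h, add_zero]
  rw [h1, h2, gf_le_count_one, gf_le_count_one, h3, h3, gf_countP] at h
  linear_combination -h

theorem sup_mem {s : Multiset ℕ} (hs : s.sup ≠ 0) : s.sup ∈ s := by
  induction s using Multiset.induction with
  | empty => simp at hs
  | cons a s ih =>
    rw [Multiset.sup_cons] at hs ⊢
    rcases le_total a s.sup with h | h
    · rw [sup_eq_right.mpr h] at hs ⊢
      exact Multiset.mem_cons_of_mem (ih hs)
    · rw [sup_eq_left.mpr h]
      exact Multiset.mem_cons_self a s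

theorem gf_sup_eq {j : ℕ} (hj : j ≠ 0) : gf (fun s => s.sup = j) = X ^ j * gfLE j := by
  have h := gf_mem_and (fun s => ∀ i ∈ s, i ≤ j) hj
  rw [gfLE, gf_congr (S := fun s => ∀ i ∈ s, i ≤ j) (T := fun s => ∀ i ∈ j ::ₘ s, i ≤ j)
    fun s _ => by simp, ← h]
  refine gf_congr fun s _ => ⟨?_, ?_⟩
  · rintro rfl
    exact ⟨sup_mem hj, fun i hi => Multiset.le_sup hi⟩
  · rintro ⟨h1, h2⟩
    exact le_antisymm (Multiset.sup_le.mpr h2) (Multiset.le_sup h1)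

theorem gf_one_notMem_sup_eq {j : ℕ} (hj : 2 ≤ j) :
    gf (fun s => 1 ∉ s ∧ s.sup = j) = (1 - X) * (X ^ j * gfLE j) := by
  have h := gf_split (fun s => s.sup = j) (fun s => 1 ∈ s)
  rw [gf_mem_and _ one_ne_zero, gf_congr (S := fun s => (1 ::ₘ s).sup = j)
    (T := fun s => s.sup = j) fun s _ => ?_, gf_sup_eq (by omega)] at h
  · linear_combination -h
  · rw [Multiset.sup_cons]
    change max 1 s.sup = j ↔ _
    omega

theorem gf_one_notMem_sup_eq_zero : gf (fun s => 1 ∉ s ∧ s.sup = 0) = 1 := by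
  rw [← gf_eq_zero]
  refine gf_congr fun s h0 => ⟨fun ⟨_, h⟩ => ?_, fun h => by simp [h]⟩
  refine Multiset.eq_zero_of_forall_notMem fun i hi => h0 ?_
  have h1 : i ≤ 0 := h ▸ Multiset.le_sup hi
  rwa [Nat.le_zero.mp h1] at hi

theorem gf_false : gf (fun _ => False) = 0 := by
  ext n
  rw [coeff_gf]
  simp

theorem gf_one_notMem_sup_eq_one : gf (fun s => 1 ∉ s ∧ s.sup = 1) = 0 := by
  rw [← gf_false]
  refine gf_congr fun s h0 => ⟨fun ⟨h1, h⟩ => ?_, False.elim⟩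
  have : s = 0 := by
    refine Multiset.eq_zero_of_forall_notMem fun i hi => ?_
    have h2 : i ≤ 1 := h ▸ Multiset.le_sup hi
    interval_cases i
    · exact h0 hi
    · exact h1 hi
  simp [this] at h

theorem one_sub_X_mul_gfLE_one : (1 - X) * gfLE 1 = 1 := by
  simpa [gfLE_zero] using one_sub_mul_gfLE 0

theorem crankParts_eq_and_count {s : Multiset ℕ} {k : ℕ} (hk : 1 ≤ k) (m : ℤ) :
    (crankParts s = m ∧ s.count 1 = k) ↔ (s.count 1 = k ∧ (s.countP (k < ·) : ℤ) = k + m) := by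
  rw [and_comm]
  refine and_congr_right fun h => ?_
  have h1 : 1 ∈ s := Multiset.count_pos.mp (by omega)
  rw [crankParts, if_pos h1, h]
  omega

theorem crankParts_eq_and_count_zero {s : Multiset ℕ} (m : ℤ) :
    (crankParts s = m ∧ s.count 1 = 0) ↔ (1 ∉ s ∧ (s.sup : ℤ) = m) := by
  rw [and_comm, Multiset.count_eq_zero]
  refine and_congr_right fun h => ?_
  rw [crankParts, if_neg h]

/-- The k-th term of the sum counts the partitions with k ones and k + m parts above k. The term k =
0 stands for partitions without ones, and there the convention at n = 1 is exactly what is needed.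
-/
theorem mk_M_natCast (m : ℕ) : PowerSeries.mk (M m) = (1 - X) * rectSum 1 1 m := by
  have h1 := (hasSum_gf (fun s => crankParts s = m) (Multiset.count 1)).add
    (hasSum_ite_eq 0 (if (m : ℤ) = 0 then -X else if (m : ℤ) = 1 then X else 0 : ℤ⟦X⟧))
  rw [← mk_M] at h1
  refine h1.unique (((hasSum_rectSum 1 1 m).mul_left (1 - X)).congr_fun fun k => ?_)
  rcases Nat.eq_zero_or_pos k with rfl | hk
  · rw [if_pos rfl, gf_congr fun s _ => crankParts_eq_and_count_zero (m : ℤ)]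
    simp only [Nat.cast_inj, gfLE_zero]
    -- The k = 0 term is (1 - q) q^m/(q)ₘ. It is 1 - q for m = 0 and q for m = 1, whereas the true
    -- counts give 1 and 0; the corrections -q and q make up the difference.
    rcases m with _ | _ | m
    · rw [gf_one_notMem_sup_eq_zero]
      simp [gfLE_zero, sub_eq_add_neg]
    · rw [gf_one_notMem_sup_eq_one]
      have := one_sub_X_mul_gfLE_one
      simp
      linear_combination -X * this
    · rw [gf_one_notMem_sup_eq (by omega), if_neg (by omega), if_neg (by omega)]
      simp
  · rw [if_neg (by omega), add_zero, gf_congr fun s _ => crankParts_eq_and_count hk (m : ℤ),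
      ← gf_count_one_eq hk]
    exact gf_congr fun s _ => by omega

/-- A negative crank forces ones to be present. With j parts above the number j + m of ones, the
summand is symmetric in the two indices, whence the symmetry of the crank. -/
theorem mk_M_neg {m : ℕ} (hm : 1 ≤ m) :
    PowerSeries.mk (M (-m)) = (1 - X) * rectSum 1 1 m := by
  -- The truncated subtraction is harmless: crank -m with m ≥ 1 forces at least m ones.
  have h1 := hasSum_gf (fun s => crankParts s = -m) (fun s => s.count 1 - m)
  have h2 := mk_M (-m)
  rw [if_neg (by omega), if_neg (by omega), add_zero] at h2
  rw [h2]
  refine h1.unique (((hasSum_rectSum 1 1 m).mul_left (1 - X)).congr_fun fun j => ?_)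
  have h3 := gf_count_one_eq (k := j + m) (by omega) j
  rw [show X ^ ((j + m) * j + 1 * j + 1 * (j + m)) * (gfLE j * gfLE (j + m)) =
    X ^ (j * (j + m) + 1 * (j + m) + 1 * j) * (gfLE (j + m) * gfLE j) by ring, ← h3]
  refine gf_congr fun s _ => ?_
  have h4 := crankParts_eq_and_count (s := s) (k := j + m) (by omega) (-m)
  constructor
  · rintro ⟨h5, h6⟩
    have h7 : m ≤ s.count 1 := by
      rw [crankParts] at h5
      split_ifs at h5 <;> omega
    have := h4.mp ⟨h5, by omega⟩
    omega
  · rintro ⟨h5, h6⟩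
    have := h4.mpr ⟨h5, by omega⟩
    omega

/-! ### Columns of Ferrers diagrams and Dyson's map -/

/-- Remove the first column of the Ferrers diagram. -/
def removeColumn (s : Multiset ℕ) : Multiset ℕ := (s.map fun i => i - 1).filter (· ≠ 0)

/-- Add a first column of length `l` to the Ferrers diagram. -/
def addColumn (l : ℕ) (s : Multiset ℕ) : Multiset ℕ :=
  (s.map fun i => i + 1) + Multiset.replicate (l - s.card) 1

/-- Add a part `c` if `c` is positive. -/
def consPos (c : ℕ) (s : Multiset ℕ) : Multiset ℕ := if c = 0 then s else c ::ₘ s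

theorem zero_notMem_removeColumn (s : Multiset ℕ) : 0 ∉ removeColumn s := by
  simp [removeColumn]

theorem zero_notMem_addColumn (l : ℕ) (s : Multiset ℕ) : 0 ∉ addColumn l s := by
  simp [addColumn, Multiset.mem_replicate]

theorem removeColumn_addColumn (l : ℕ) {s : Multiset ℕ} (h0 : 0 ∉ s) :
    removeColumn (addColumn l s) = s := by
  have h : ∀ i ∈ s, i ≠ 0 := fun i hi h => h0 (h ▸ hi)
  have h2 : Multiset.filter (· ≠ 0) (Multiset.replicate (l - s.card) 0) = 0 :=
    Multiset.filter_eq_nil.mpr fun i hi => by simp [Multiset.eq_of_mem_replicate hi]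
  simp only [removeColumn, addColumn, Multiset.map_add, Multiset.map_map, Function.comp_def,
    add_tsub_cancel_right, Multiset.map_id', Multiset.map_replicate, tsub_self,
    Multiset.filter_add, h2, add_zero]
  exact Multiset.filter_eq_self.mpr h

theorem card_removeColumn_le (s : Multiset ℕ) : (removeColumn s).card ≤ s.card :=
  (Multiset.card_le_card (Multiset.filter_le _ _)).trans (by simp)

theorem removeColumn_cons (a : ℕ) (s : Multiset ℕ) :
    removeColumn (a ::ₘ s) = consPos (a - 1) (removeColumn s) := by
  rw [removeColumn, consPos, Multiset.map_cons, Multiset.filter_cons]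
  split_ifs <;> simp_all [removeColumn]

theorem addColumn_removeColumn {s : Multiset ℕ} (h0 : 0 ∉ s) :
    addColumn s.card (removeColumn s) = s := by
  induction s using Multiset.induction with
  | empty => rfl
  | cons a s ih =>
    rw [Multiset.mem_cons, not_or] at h0
    have h1 := card_removeColumn_le s
    have h2 := ih h0.2
    rw [removeColumn_cons, consPos]
    rw [addColumn] at h2 ⊢
    split_ifs with h
    · rw [Multiset.card_cons, Nat.sub_add_comm h1, Multiset.replicate_succ, Multiset.add_cons, h2]
      congr 1
      omega
    · rw [Multiset.card_cons, Multiset.card_cons, Nat.add_sub_add_right, Multiset.map_cons,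
        Multiset.cons_add, h2]
      congr 1
      omega

theorem card_addColumn {l : ℕ} {s : Multiset ℕ} (h : s.card ≤ l) : (addColumn l s).card = l := by
  simp [addColumn, h]

theorem sum_addColumn {l : ℕ} {s : Multiset ℕ} (h : s.card ≤ l) :
    (addColumn l s).sum = s.sum + l := by
  simp [addColumn, Multiset.sum_map_add, add_assoc, h]

theorem sum_removeColumn {s : Multiset ℕ} (h0 : 0 ∉ s) :
    (removeColumn s).sum + s.card = s.sum := by
  rw [← sum_addColumn (card_removeColumn_le s), addColumn_removeColumn h0]

theorem sup_addColumn_le (l : ℕ) (s : Multiset ℕ) : (addColumn l s).sup ≤ s.sup + 1 := by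
  refine Multiset.sup_le.mpr fun i hi => ?_
  rw [addColumn, Multiset.mem_add, Multiset.mem_map] at hi
  rcases hi with ⟨j, hj, rfl⟩ | hi
  · exact Nat.add_le_add_right (Multiset.le_sup hj) 1
  · rw [Multiset.eq_of_mem_replicate hi]
    omega

theorem sup_removeColumn_le (s : Multiset ℕ) : (removeColumn s).sup ≤ s.sup - 1 := by
  refine Multiset.sup_le.mpr fun i hi => ?_
  rw [removeColumn, Multiset.mem_filter, Multiset.mem_map] at hi
  obtain ⟨⟨j, hj, rfl⟩, _⟩ := hi
  exact Nat.sub_le_sub_right (Multiset.le_sup hj) 1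

theorem zero_notMem_consPos {c : ℕ} {s : Multiset ℕ} (h0 : 0 ∉ s) : 0 ∉ consPos c s := by
  rw [consPos]
  split_ifs with h
  · exact h0
  · simpa [h0] using Ne.symm h

theorem sup_consPos {c : ℕ} {s : Multiset ℕ} (h : s.sup ≤ c) : (consPos c s).sup = c := by
  rw [consPos]
  split_ifs with hc
  · omega
  · rw [Multiset.sup_cons, sup_eq_left.mpr h]

theorem erase_consPos {c : ℕ} {s : Multiset ℕ} (h0 : 0 ∉ s) : (consPos c s).erase c = s := by
  rw [consPos]
  split_ifs with hc
  · rw [hc, Multiset.erase_of_notMem h0]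
  · rw [Multiset.erase_cons_head]

theorem sum_consPos (c : ℕ) (s : Multiset ℕ) : (consPos c s).sum = s.sum + c := by
  rw [consPos]
  split_ifs with hc
  · omega
  · rw [Multiset.sum_cons, add_comm]

theorem card_consPos_le (c : ℕ) (s : Multiset ℕ) : (consPos c s).card ≤ s.card + min c 1 := by
  rw [consPos]
  split_ifs with hc
  · omega
  · rw [Multiset.card_cons]
    omega

theorem sup_ne_zero {s : Multiset ℕ} (h0 : 0 ∉ s) (hs : s ≠ 0) : s.sup ≠ 0 := by
  obtain ⟨i, hi⟩ := Multiset.exists_mem_of_ne_zero hs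
  have h1 := Multiset.le_sup hi
  have h2 : i ≠ 0 := fun h => h0 (h ▸ hi)
  omega

theorem consPos_sup_erase {s : Multiset ℕ} (h0 : 0 ∉ s) : consPos s.sup (s.erase s.sup) = s := by
  rcases eq_or_ne s 0 with rfl | hs
  · rfl
  · have h := sup_ne_zero h0 hs
    rw [consPos, if_neg h, Multiset.cons_erase (sup_mem h)]

theorem card_erase_sup {s : Multiset ℕ} (h0 : 0 ∉ s) :
    (s.erase s.sup).card = s.card - 1 := by
  rcases eq_or_ne s 0 with rfl | hs
  · rfl
  · rw [Multiset.card_erase_of_mem (sup_mem (sup_ne_zero h0 hs)), Nat.pred_eq_sub_one]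

theorem sup_erase_le (s : Multiset ℕ) (i : ℕ) : (s.erase i).sup ≤ s.sup :=
  Multiset.sup_mono (Multiset.subset_of_le (Multiset.erase_le _ _))

theorem zero_notMem_erase {s : Multiset ℕ} (h0 : 0 ∉ s) (i : ℕ) : 0 ∉ s.erase i := fun h =>
  h0 (Multiset.mem_of_mem_erase h)

/-- The rank of the partition with multiset of parts `s`. -/
def rankParts (s : Multiset ℕ) : ℤ := (s.sup : ℤ) - (s.card : ℤ)

/-- Dyson's map: a first column of length `l` is replaced by a part of size `l + r`. -/
theorem gf_le_rank {r : ℕ} (hr : 2 ≤ r) :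
    gf (fun s => (r - 1 : ℤ) ≤ rankParts s) = X ^ r * gf (fun s => rankParts s ≤ r + 1) := by
  refine gf_shift r (fun s => consPos (s.card + r) (removeColumn s))
    (fun s => addColumn (s.sup - r) (s.erase s.sup)) ?_ ?_
  · intro s h0 hs
    rw [rankParts] at hs
    have h1 := sup_removeColumn_le s
    have h2 := card_removeColumn_le s
    have h3 := sum_removeColumn h0
    have h4 := card_consPos_le (s.card + r) (removeColumn s)
    -- Rank at most r + 1 says exactly that the new part is at least as large as what remains, so
    -- the inverse can find it as the largest part.
    have h5 : (consPos (s.card + r) (removeColumn s)).sup = s.card + r := sup_consPos (by omega)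
    refine ⟨zero_notMem_consPos (zero_notMem_removeColumn s), ?_, ?_, ?_⟩
    · rw [rankParts, h5]
      omega
    · rw [sum_consPos]
      omega
    · rw [h5, erase_consPos (zero_notMem_removeColumn s), Nat.add_sub_cancel,
        addColumn_removeColumn h0]
  · intro t h0 ht
    rw [rankParts] at ht
    have h1 := card_erase_sup h0
    have h2 := sup_erase_le t t.sup
    -- The empty partition has rank 0 < r - 1; this is where r ≥ 2 enters.
    have h3 : t.card ≠ 0 := by
      intro h
      rw [Multiset.card_eq_zero.mp h] at ht
      simp at ht
      omega
    have h4 := sup_addColumn_le (t.sup - r) (t.erase t.sup)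
    have h5 : r ≤ t.sup := by omega
    have h6 : (addColumn (t.sup - r) (t.erase t.sup)).card = t.sup - r := card_addColumn (by omega)
    refine ⟨zero_notMem_addColumn _ _, ?_, ?_⟩
    · rw [rankParts, h6]
      omega
    · rw [h6, removeColumn_addColumn _ (zero_notMem_erase h0 _), Nat.sub_add_cancel h5,
        consPos_sup_erase h0]

/-- The conjugate of Dyson's map: the largest part a becomes a first column of length a + r, which
is long enough exactly when the rank is at least -(r + 1). The empty partition counts as having a =
0, which is why the inverse uses `consPos`. -/
theorem gf_rank_le {r : ℕ} (hr : 2 ≤ r) :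
    gf (fun s => rankParts s ≤ -(r - 1 : ℤ)) =
      X ^ r * gf (fun s => -(r + 1 : ℤ) ≤ rankParts s) := by
  refine gf_shift r (fun s => addColumn (s.sup + r) (s.erase s.sup))
    (fun s => consPos (s.card - r) (removeColumn s)) ?_ ?_
  · intro s h0 hs
    rw [rankParts] at hs
    have h1 := card_erase_sup h0
    have h2 := sup_erase_le s s.sup
    have h4 := sup_addColumn_le (s.sup + r) (s.erase s.sup)
    have h5 : (s.erase s.sup).card ≤ s.sup + r := by omega
    have h6 := card_addColumn h5
    refine ⟨zero_notMem_addColumn _ _, ?_, ?_, ?_⟩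
    · rw [rankParts, h6]
      omega
    · rw [sum_addColumn h5, ← add_assoc, ← sum_consPos, consPos_sup_erase h0]
    · rw [h6, removeColumn_addColumn _ (zero_notMem_erase h0 _), Nat.add_sub_cancel,
        consPos_sup_erase h0]
  · intro t h0 ht
    rw [rankParts] at ht
    have h1 := sup_removeColumn_le t
    have h2 := card_removeColumn_le t
    have h4 := card_consPos_le (t.card - r) (removeColumn t)
    have h7 : t.sup ≠ 0 := by
      refine sup_ne_zero h0 ?_
      rintro rfl
      simp at ht
      omega
    have h5 : (consPos (t.card - r) (removeColumn t)).sup = t.card - r := sup_consPos (by omega)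
    refine ⟨zero_notMem_consPos (zero_notMem_removeColumn t), ?_, ?_⟩
    · rw [rankParts, h5]
      omega
    · rw [h5, erase_consPos (zero_notMem_removeColumn t), Nat.sub_add_cancel (by omega),
        addColumn_removeColumn h0]

theorem gf_rank_le_add (r : ℤ) :
    gf (fun s => rankParts s ≤ r) + gf (fun s => r + 1 ≤ rankParts s) = gfAll := by
  rw [gfAll, gf_split (fun _ => True) (fun s => rankParts s ≤ r)]
  congr 1 <;> exact gf_congr fun s _ => by simp

theorem mk_N (m : ℤ) : PowerSeries.mk (N m) = gf fun s => rankParts s = m := by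
  ext n
  rw [PowerSeries.coeff_mk, coeff_gf]
  rfl

theorem gf_le_rank_eq (r : ℤ) :
    gf (fun s => r ≤ rankParts s) = PowerSeries.mk (N r) + gf (fun s => r + 1 ≤ rankParts s) := by
  rw [mk_N, gf_split (fun s => r ≤ rankParts s) (fun s => rankParts s = r)]
  congr 1 <;> exact gf_congr fun s _ => by omega

/-! ### Comparison of rank and crank -/

/-- The generating function of partitions with rank in `{3 m - 1, 3 m, 3 m + 1}`. -/
def rankSeries (m : ℤ) : ℤ⟦X⟧ :=
  PowerSeries.mk fun n => N (3 * m) n + N (3 * m + 1) n + N (3 * m - 1) n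

theorem rankSeries_eq (m : ℤ) : rankSeries m =
    gf (fun s => 3 * m - 1 ≤ rankParts s) - gf (fun s => 3 * m + 2 ≤ rankParts s) := by
  have h1 := gf_le_rank_eq (3 * m - 1)
  have h2 := gf_le_rank_eq (3 * m)
  have h3 := gf_le_rank_eq (3 * m + 1)
  rw [sub_add_cancel] at h1
  rw [add_assoc, show (1 + 1 : ℤ) = 2 by norm_num] at h3
  have h4 : rankSeries m = PowerSeries.mk (N (3 * m)) + PowerSeries.mk (N (3 * m + 1)) +
    PowerSeries.mk (N (3 * m - 1)) := rfl
  rw [h4, h1, h2, h3]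
  ring

/-- Dyson's map with r = 3m; the complement of rank at most 3m + 1 is rank at least 3(m + 1) - 1,
the next tail. -/
theorem gf_le_rank_rec {m : ℕ} (hm : 1 ≤ m) : gf (fun s => 3 * (m : ℤ) - 1 ≤ rankParts s) =
    X ^ (3 * m) * (gfAll - gf (fun s => 3 * ((m + 1 : ℕ) : ℤ) - 1 ≤ rankParts s)) := by
  have h := gf_le_rank (r := 3 * m) (by omega)
  rw [← gf_rank_le_add (3 * m + 1)]
  push_cast at h ⊢
  rw [h, show 3 * ((m : ℤ) + 1) - 1 = 3 * m + 1 + 1 by ring, add_sub_cancel_right]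

theorem gf_rank_le_rec {m : ℕ} (hm : 1 ≤ m) : gf (fun s => rankParts s ≤ -(3 * (m : ℤ) - 1)) =
    X ^ (3 * m) * (gfAll - gf (fun s => rankParts s ≤ -(3 * ((m + 1 : ℕ) : ℤ) - 1))) := by
  have h := gf_rank_le (r := 3 * m) (by omega)
  rw [← gf_rank_le_add (-(3 * ((m + 1 : ℕ) : ℤ) - 1))]
  push_cast at h ⊢
  rw [h, show -(3 * ((m : ℤ) + 1) - 1) + 1 = -(3 * (m : ℤ) + 1) by ring, add_sub_cancel_left]

/-- Substitution of `q ^ 3` for `q`. -/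
abbrev expand3 : ℤ⟦X⟧ →ₐ[ℤ] ℤ⟦X⟧ := PowerSeries.expand 3 three_ne_zero

theorem expand3_crank_rec (m : ℕ) : gfAll * expand3 (rectSum 0 1 m) =
    X ^ (3 * m) * (gfAll * expand3 gfAll - gfAll * expand3 (rectSum 0 1 (m + 1))) := by
  conv_lhs => rw [rectSum_zero_one_rec]
  rw [map_mul, map_pow, PowerSeries.expand_X, map_sub]
  ring

theorem expand3_mul_gf_le_rank {m : ℕ} (hm : 1 ≤ m) :
    expand3 gfAll * gf (fun s => 3 * (m : ℤ) - 1 ≤ rankParts s) =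
      gfAll * expand3 (rectSum 0 1 m) :=
  eq_of_rec (A := fun m => expand3 gfAll * gf (fun s => 3 * (m : ℤ) - 1 ≤ rankParts s))
    (B := fun m => gfAll * expand3 (rectSum 0 1 m)) (P := gfAll * expand3 gfAll)
    (fun m hm => by
      rw [gf_le_rank_rec hm]
      ring) (fun m _ => expand3_crank_rec m) hm

theorem expand3_mul_gf_rank_le {m : ℕ} (hm : 1 ≤ m) :
    expand3 gfAll * gf (fun s => rankParts s ≤ -(3 * (m : ℤ) - 1)) =
      gfAll * expand3 (rectSum 0 1 m) :=
  eq_of_rec (A := fun m => expand3 gfAll * gf (fun s => rankParts s ≤ -(3 * (m : ℤ) - 1)))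
    (B := fun m => gfAll * expand3 (rectSum 0 1 m)) (P := gfAll * expand3 gfAll)
    (fun m hm => by
      rw [gf_rank_le_rec hm]
      ring) (fun m _ => expand3_crank_rec m) hm

/-- The rank-crank identity for the coefficient of `w ^ m`. -/
theorem expand3_mul_rankSeries (m : ℤ) :
    expand3 gfAll * rankSeries m = gfAll * expand3 (PowerSeries.mk (M m)) := by
  rw [rankSeries_eq]
  rcases lt_trichotomy m 0 with hm | rfl | hm
  · obtain ⟨k, rfl⟩ : ∃ k : ℕ, m = -k := ⟨m.natAbs, by omega⟩
    have hk : 1 ≤ k := by omega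
    rw [mk_M_neg hk, one_sub_X_mul_rectSum, map_sub, mul_sub _ (expand3 _),
      ← expand3_mul_gf_rank_le hk, ← expand3_mul_gf_rank_le (m := k + 1) (by omega)]
    have h1 := gf_rank_le_add (3 * -(k : ℤ) - 2)
    have h2 := gf_rank_le_add (3 * -(k : ℤ) + 1)
    push_cast
    rw [show -(3 * ((k : ℤ) + 1) - 1) = 3 * -(k : ℤ) - 2 by ring,
      show -(3 * (k : ℤ) - 1) = 3 * -(k : ℤ) + 1 by ring]
    rw [show 3 * -(k : ℤ) - 2 + 1 = 3 * -(k : ℤ) - 1 by ring] at h1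
    rw [show 3 * -(k : ℤ) + 1 + 1 = 3 * -(k : ℤ) + 2 by ring] at h2
    linear_combination expand3 gfAll * (h1 - h2)
  -- Ranks -1, 0, 1 are what remains of P after removing the tails at least 2 and at most -2. On the
  -- crank side B 0 = P - B 1 likewise gives B 0 - B 1 = P - 2 B 1.
  · have h1 := expand3_mul_gf_le_rank (m := 1) le_rfl
    have h2 := expand3_mul_gf_rank_le (m := 1) le_rfl
    have h3 := expand3_crank_rec 0
    have h4 := gf_rank_le_add (-2)
    have h5 := mk_M_natCast 0
    rw [one_sub_X_mul_rectSum, Nat.cast_zero] at h5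
    rw [h5, map_sub]
    norm_num at h1 h2 h3 h4 ⊢
    linear_combination expand3 gfAll * h4 - h1 - h2 - h3
  · obtain ⟨k, rfl⟩ : ∃ k : ℕ, m = k := ⟨m.natAbs, by omega⟩
    have hk : 1 ≤ k := by omega
    rw [mk_M_natCast, one_sub_X_mul_rectSum, map_sub, mul_sub _ (expand3 _),
      ← expand3_mul_gf_le_rank hk, ← expand3_mul_gf_le_rank (m := k + 1) (by omega)]
    push_cast
    rw [show 3 * ((k : ℤ) + 1) - 1 = 3 * k + 2 by ring]
    ring

/-! ### Infinite products and double sums over Laurent polynomials -/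

open Filter Topology

/-- The inclusion of power series with integer coefficients. -/
abbrev inclusion : ℤ⟦X⟧ →+* ℤ[T;T⁻¹]⟦X⟧ := PowerSeries.map (Int.castRingHom ℤ[T;T⁻¹])

theorem prod_one_sub_mul_gfLE (n : ℕ) :
    (∏ j ∈ Finset.range n, (1 - X ^ (j + 1))) * gfLE n = 1 := by
  induction n with
  | zero => simp [gfLE_zero]
  | succ n ih => rw [Finset.prod_range_succ, mul_assoc, one_sub_mul_gfLE, ih]

/-- `(q ^ k; q ^ k)_∞` is the inverse of the generating function of partitions at `q ^ k`. -/
theorem qPochInf_mul_expand {k : ℕ} (hk : k ≠ 0) :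
    qPochInf (q ^ k) (q ^ k) * inclusion (PowerSeries.expand k hk gfAll) = 1 := by
  have h1 := (multipliable_qPochInf k (Nat.pos_of_ne_zero hk)).tendsto_prod_tprod_nat
  have h2 : Tendsto (fun n => inclusion (PowerSeries.expand k hk (gfLE n))) atTop
      (𝓝 (inclusion (PowerSeries.expand k hk gfAll))) := by
    rw [PowerSeries.WithPiTopology.tendsto_iff_coeff_tendsto]
    intro d
    refine tendsto_atTop_of_eventually_const (i₀ := d) fun n hn => ?_
    rw [PowerSeries.coeff_map, PowerSeries.coeff_map, PowerSeries.coeff_expand,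
      PowerSeries.coeff_expand, coeff_gfLE ((Nat.div_le_self d k).trans hn)]
  -- Each partial product times `gfLE n` at q^k is 1, and both factors converge.
  refine tendsto_nhds_unique (h1.mul h2) (tendsto_const_nhds.congr fun n => ?_)
  have h3 := congrArg (fun f => inclusion (PowerSeries.expand k hk f)) (prod_one_sub_mul_gfLE n)
  simp only [map_mul, map_prod, map_sub, map_one, map_pow, PowerSeries.expand_X,
    PowerSeries.map_X] at h3
  refine h3.symm.trans (congrArg (· * _) (Finset.prod_congr rfl fun j _ => ?_))
  rw [pow_succ', q]

/-- A family of monomials `c m n w ^ m q ^ (k n)` is summable if, for each `n`, only finitely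
many `c m n` are nonzero. -/
theorem summable_monomials {k : ℕ} (hk : k ≠ 0) {c : ℤ → ℕ → ℤ}
    (hc : ∀ n, {m | c m n ≠ 0}.Finite) :
    Summable fun x : ℤ × ℕ => c x.1 x.2 • (wPow x.1 * q ^ (k * x.2)) := by
  refine PowerSeries.WithPiTopology.summable_iff_summable_coeff _ |>.mpr fun d => ?_
  refine summable_of_hasFiniteSupport (((hc (d / k)).prod (Set.finite_singleton (d / k))).subset
    fun x hx => ?_)
  rw [Function.mem_support, map_zsmul, wPow, PowerSeries.coeff_C_mul, q,
    PowerSeries.coeff_X_pow] at hx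
  have h1 : d = k * x.2 := by
    by_contra h
    simp [h] at hx
  have h2 : d / k = x.2 := by rw [h1, Nat.mul_div_cancel_left _ (Nat.pos_of_ne_zero hk)]
  rw [h2]
  refine ⟨fun h => hx ?_, rfl⟩
  rw [h, zero_smul]

theorem hasSum_monomials {k : ℕ} (hk : k ≠ 0) (c : ℕ → ℤ) (m : ℤ) :
    HasSum (fun n => c n • (wPow m * q ^ (k * n)))
      (wPow m * inclusion (PowerSeries.expand k hk (PowerSeries.mk c))) := by
  have h : HasSum (fun n => c n • q ^ (k * n))
      (inclusion (PowerSeries.expand k hk (PowerSeries.mk c))) := by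
    rw [PowerSeries.WithPiTopology.hasSum_iff_hasSum_coeff]
    intro d
    rw [PowerSeries.coeff_map, PowerSeries.coeff_expand]
    simp only [map_zsmul, q, PowerSeries.coeff_X_pow]
    have hk' := Nat.pos_of_ne_zero hk
    split_ifs with hd
    · obtain ⟨e, rfl⟩ := hd
      rw [Nat.mul_div_cancel_left _ hk', PowerSeries.coeff_mk]
      convert hasSum_single e fun n hn => ?_ using 1
      · simp
      · rw [if_neg fun h => hn (Nat.eq_of_mul_eq_mul_left hk' h).symm, smul_zero]
    · convert hasSum_zero with n
      · rw [if_neg fun h => hd ⟨n, h⟩, smul_zero]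
      · simp
  simpa only [mul_smul_comm] using h.mul_left (wPow m)

theorem finite_N_ne_zero (n : ℕ) : {m | N m n ≠ 0}.Finite := by
  refine (Set.finite_range fun p : n.Partition => rank p).subset fun m hm => ?_
  rw [Set.mem_ofPred_eq, N, Nat.cast_ne_zero, Finset.card_ne_zero] at hm
  obtain ⟨p, hp⟩ := hm
  exact ⟨p, (Finset.mem_filter.mp hp).2⟩

theorem finite_M_ne_zero (n : ℕ) : {m | M m n ≠ 0}.Finite := by
  refine ((Set.finite_range fun p : n.Partition => crank p).union
    (Set.toFinite {0, 1, -1})).subset fun m hm => ?_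
  rw [Set.mem_ofPred_eq, M] at hm
  split_ifs at hm with h1 h2 h3
  · simp [h2]
  · rcases h3 with h3 | h3 <;> simp [h3]
  · exact absurd rfl hm
  · rw [Nat.cast_ne_zero, Finset.card_ne_zero] at hm
    obtain ⟨p, hp⟩ := hm
    exact Or.inl ⟨p, (Finset.mem_filter.mp hp).2⟩

theorem finite_rank_ne_zero (n : ℕ) :
    {m : ℤ | N (3 * m) n + N (3 * m + 1) n + N (3 * m - 1) n ≠ 0}.Finite := by
  have h : ∀ r : ℤ, {m : ℤ | N (3 * m + r) n ≠ 0}.Finite := fun r =>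
    (finite_N_ne_zero n).preimage fun a _ b _ hab => by
      have h : 3 * a + r = 3 * b + r := hab
      omega
  refine (((h 0).union (h 1)).union (h (-1))).subset fun m hm => ?_
  by_contra h'
  simp only [Set.mem_union, Set.mem_ofPred_eq, not_or, not_not, add_zero, ← sub_eq_add_neg] at h'
  exact hm (by rw [h'.1.1, h'.1.2, h'.2]; rfl)

end RankCrank

end

open RankCrank in
theorem mainTheorem6 :
    (Summable fun x : ℤ × ℕ =>
      (RankCrank.N (3 * x.1) x.2 + RankCrank.N (3 * x.1 + 1) x.2 + RankCrank.N (3 * x.1 - 1) x.2) •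
        (RankCrank.wPow x.1 * RankCrank.q ^ x.2)) ∧
    (Summable fun x : ℤ × ℕ =>
      RankCrank.M x.1 x.2 • (RankCrank.wPow x.1 * RankCrank.q ^ (3 * x.2))) ∧
    ∑' x : ℤ × ℕ,
      (RankCrank.N (3 * x.1) x.2 + RankCrank.N (3 * x.1 + 1) x.2 + RankCrank.N (3 * x.1 - 1) x.2) •
        (RankCrank.wPow x.1 * RankCrank.q ^ x.2) =
      RankCrank.qPochInf (RankCrank.q ^ 3) (RankCrank.q ^ 3) * RankCrank.invQPochInf *
        ∑' x : ℤ × ℕ, RankCrank.M x.1 x.2 • (RankCrank.wPow x.1 * RankCrank.q ^ (3 * x.2)) := by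
  have hs1 := summable_monomials one_ne_zero finite_rank_ne_zero
  have hs2 := summable_monomials three_ne_zero finite_M_ne_zero
  simp only [one_mul] at hs1
  refine ⟨hs1, hs2, ?_⟩
  have h1 := hs1.hasSum.prod_fiberwise fun m => by
    simpa only [one_mul, PowerSeries.expand_one_apply] using hasSum_monomials one_ne_zero
      (fun n => N (3 * m) n + N (3 * m + 1) n + N (3 * m - 1) n) m
  have h2 := hs2.hasSum.prod_fiberwise fun m => hasSum_monomials three_ne_zero (M m) m
  -- The two double sums, summed first over n, agree term by term in m after multiplication by
  -- P(q^3) and P(q) respectively.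
  have h3 : inclusion (expand3 gfAll) * _ = inclusion gfAll * _ :=
    (h1.mul_left (inclusion (expand3 gfAll))).unique
      ((h2.mul_left (inclusion gfAll)).congr_fun fun m => by
        have h := congrArg inclusion (expand3_mul_rankSeries m)
        rw [map_mul, map_mul] at h
        rw [mul_left_comm, mul_left_comm (inclusion gfAll)]
        exact congrArg (wPow m * ·) h)
  have h4 := qPochInf_mul_expand three_ne_zero
  have h5 := qPochInf_mul_expand one_ne_zero
  rw [pow_one, PowerSeries.expand_one_apply] at h5
  -- Both are inverses of (q; q)_∞.
  have h6 : invQPochInf = inclusion gfAll := by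
    linear_combination inclusion gfAll * qPochInf_mul_inv - invQPochInf * h5
  rw [h6, mul_assoc, ← h3, ← mul_assoc, h4, one_mul]
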